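/- Let $J=J_{2n}=\begin{bmatrix}0&I_n\\-I_n&0\end{bmatrix}$ and let $S\in M_{2n}(\mathbb C)$ be symplectic, i.e. $S^TJS=J$. Let $\lambda_1\in\sigma(S)$ and $\mu\in\mathbb C\setminus\{0,\lambda_1,\lambda_1^{-1}\}$. Let $x_1,x_2\in\mathbb C^{2n}$ be eigenvectors of $S$ for $\lambda_1$ and $\lambda_1^{-1}$, respectively, normalized such that $X=[\,x_1\;x_2\,]$ satisfies $X^TJX=J_2$. Let $R=[r_{ij}]\in M_2(\mathbb C)$ satisfy $$(\mu+\mu^{-1})-(\lambda_1+\lambda_1^{-1})=\lambda_1r_{12}-\lambda_1^{-1}r_{21},\qquad 0=r_{12}-r_{21}+r_{11}r_{22}-r_{12}r_{21},$$ and put $\hat S=S+XRX^TJ^TS$. The Segre characteristic $((\cdot,\ldots,\cdot))$ of a number $\lambda$ for a matrix $A$ is the list, in non-increasing order, of the sizes of the Jordan blocks of $A$ with eigenvalue $\lambda$ (empty if $\lambda\notin\sigma(A)$). Then the following hold. (i) Let $((s_k,s_{k-1},\ldots,s_1))$ be the Segre characteristic of $\lambda_1$ for $S$. If $\lambda_1\neq\pm1$,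 then $s_1=1$ and the Segre characteristic of $\lambda_1$ for $\hat S$ is $((s_k,\ldots,s_2))$. If $\lambda_1=\pm1$, then $k\ge2$, $s_2=s_1=1$ and the Segre characteristic of $\lambda_1$ for $\hat S$ is $((s_k,\ldots,s_3))$. (ii) Let $\mu\notin\sigma(S)$. If $\mu\neq\mu^{-1}$, then the Segre characteristic of $\mu$ for $\hat S$ is $((1))$. If $\mu=\mu^{-1}$, it is $((1,1))$ if and only if $R=R_1$ or $R=R_2$, where $$R_1=\begin{bmatrix}0&\lambda_1^{-1}(\mu-\lambda_1)\\ \mu^{-1}(\mu-\lambda_1)&0\end{bmatrix},\qquad R_2=\begin{bmatrix}0&\mu^{-1}(\lambda_1^{-1}-\mu)\\ \lambda_1(\lambda_1^{-1}-\mu)&0\end{bmatrix},$$ and otherwise it is $((2))$. -/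

import Mathlib

open Matrix

noncomputable section

/-- The skew-symmetric matrix `J = J_{2n} = [0, I; -I, 0]`, the two halves of the coordinates being
indexed by the two summands of `Fin n ⊕ Fin n`. It is the negative of Mathlib's `Matrix.J`. -/
def matJ (n : ℕ) : Matrix (Fin n ⊕ Fin n) (Fin n ⊕ Fin n) ℂ :=
  Matrix.fromBlocks 0 1 (-1) 0

/-- The matrix `J_2`, with plain indices. -/
def matJ2 : Matrix (Fin 2) (Fin 2) ℂ := !![0, 1; -1, 0]

/-- A complex `2n × 2n` matrix is symplectic if `Sᵀ J S = J` (plain transpose). -/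
def IsSymplecticMatrix {n : ℕ} (S : Matrix (Fin n ⊕ Fin n) (Fin n ⊕ Fin n) ℂ) : Prop :=
  Sᵀ * matJ n * S = matJ n

/-- Agreement with Mathlib's symplectic group. -/
theorem isSymplecticMatrix_iff_mem {n : ℕ} (S : Matrix (Fin n ⊕ Fin n) (Fin n ⊕ Fin n) ℂ) :
    IsSymplecticMatrix S ↔ S ∈ Matrix.symplecticGroup (Fin n) ℂ := by
  have h : matJ n = -Matrix.J (Fin n) ℂ := by
    simp [matJ, Matrix.J, Matrix.fromBlocks_neg]
  rw [SymplecticGroup.mem_iff', IsSymplecticMatrix, h]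
  simp

/-- The matrix `X = [x₁ x₂]` with the two columns `x₁`, `x₂`. -/
def colPair {m : Type*} (x₁ x₂ : m → ℂ) : Matrix m (Fin 2) ℂ :=
  Matrix.of fun i j => ![x₁ i, x₂ i] j

/-- The modified matrix `Ŝ = S + X R Xᵀ Jᵀ S`. -/
def modifiedMatrix {n : ℕ} (S : Matrix (Fin n ⊕ Fin n) (Fin n ⊕ Fin n) ℂ)
    (X : Matrix (Fin n ⊕ Fin n) (Fin 2) ℂ) (R : Matrix (Fin 2) (Fin 2) ℂ) :
    Matrix (Fin n ⊕ Fin n) (Fin n ⊕ Fin n) ℂ :=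
  S + X * R * Xᵀ * (matJ n)ᵀ * S

/-- The matrix `R₁`. -/
def matR1 (lam μ : ℂ) : Matrix (Fin 2) (Fin 2) ℂ :=
  !![0, lam⁻¹ * (μ - lam); μ⁻¹ * (μ - lam), 0]

/-- The matrix `R₂`. -/
def matR2 (lam μ : ℂ) : Matrix (Fin 2) (Fin 2) ℂ :=
  !![0, μ⁻¹ * (lam⁻¹ - μ); lam * (lam⁻¹ - μ), 0]

/-- The `d × d` Jordan block with eigenvalue `lam`, with ones on the superdiagonal. -/
def jordanBlock (lam : ℂ) (d : ℕ) : Matrix (Fin d) (Fin d) ℂ :=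
  Matrix.of fun i j => if i = j then lam else if (i : ℕ) + 1 = (j : ℕ) then 1 else 0

/-- The block diagonal matrix with Jordan blocks of sizes `d i` and eigenvalues `ev i`. -/
def jordanMatrix {k : ℕ} (d : Fin k → ℕ) (ev : Fin k → ℂ) :
    Matrix ((i : Fin k) × Fin (d i)) ((i : Fin k) × Fin (d i)) ℂ :=
  Matrix.blockDiagonal' fun i => jordanBlock (ev i) (d i)

/-- `A` has a Jordan normal form with `k` blocks, of (positive) sizes `d i` and eigenvalues `ev i`:
it is similar to the block diagonal matrix of these Jordan blocks. -/
def HasJordanForm {m : Type*} [Fintype m] [DecidableEq m] (A : Matrix m m ℂ)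
    {k : ℕ} (d : Fin k → ℕ) (ev : Fin k → ℂ) : Prop :=
  (∀ i, 0 < d i) ∧
    ∃ (P : Matrix m ((i : Fin k) × Fin (d i)) ℂ) (Q : Matrix ((i : Fin k) × Fin (d i)) m ℂ),
      P * Q = 1 ∧ Q * P = 1 ∧ A = P * jordanMatrix d ev * Q

/-- `s` is the Segre characteristic of `lam` for `A`: the list, in non-increasing order, of the
sizes of the Jordan blocks with eigenvalue `lam` in a Jordan normal form of `A` (counted with
multiplicity). It is empty exactly when `lam` is not an eigenvalue of `A`. -/
def IsSegreCharacteristic {m : Type*} [Fintype m] [DecidableEq m] (A : Matrix m m ℂ)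
    (lam : ℂ) (s : List ℕ) : Prop :=
  s.Pairwise (· ≥ ·) ∧
    ∃ (k : ℕ) (d : Fin k → ℕ) (ev : Fin k → ℂ), HasJordanForm A d ev ∧
      (s : Multiset ℕ) = (Finset.univ.filter fun i => ev i = lam).val.map d

end

open Module

/-! A Segre characteristic is determined by the numbers `jordanNullity A lam j`, since a block of
size `d` at `lam` contributes `min d j`, and the sums of these for all `j` recover the multiset of
sizes. It therefore suffices to compare nullities of `S` and `Ŝ`.

Put `Y = Xᵀ J`. As `Y X = J₂` is invertible, the space is the direct sum of the range of `X` and the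
kernel of `Y`. Both summands are invariant under `S` and `Ŝ`, and `Ŝ - S` factors through `Y`, so
the two matrices agree on `ker Y`. On the range of `X`, `S` acts as `diag(lam, lam⁻¹)` and `Ŝ` as
`spanMatrix lam R`, whose eigenvalues are `μ` and `μ⁻¹` by the two conditions on `R`. Passing from
`S` to `Ŝ` only exchanges these 2 × 2 summands (`exists_common_nullity`).

At `lam` this removes one block of size 1, or two if `lam = ±1`. At `μ ∉ σ(S)` only the 2 × 2 matrix
counts. Existence of a Jordan form comes from the structure theorem over `ℂ[X]`. -/

/-- The dimension of the kernel of `(A - lam) ^ j`. -/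
noncomputable def jordanNullity {m : Type*} [Fintype m] [DecidableEq m] (A : Matrix m m ℂ)
    (lam : ℂ) (j : ℕ) : ℕ :=
  finrank ℂ (LinearMap.ker (toLin' ((A - lam • (1 : Matrix m m ℂ)) ^ j)))

/-! ### Recovering a multiset of sizes from truncated sums -/

section Lists

/-- The second difference of `j ↦ min a j` is supported at `j = a`, so second differences of the
sums count multiplicities. -/
theorem two_mul_sum_map_min (s : Multiset ℕ) (c : ℕ) :
    2 * (s.map (min · (c + 1))).sum =
      (s.map (min · c)).sum + (s.map (min · (c + 2))).sum + s.count (c + 1) := by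
  induction s using Multiset.induction_on with
  | empty => simp
  | cons a s ih =>
    simp only [Multiset.map_cons, Multiset.sum_cons, Multiset.count_cons]
    split_ifs <;> omega

theorem Multiset.eq_of_sum_map_min_eq {s t : Multiset ℕ} (hs : ∀ d ∈ s, 0 < d)
    (ht : ∀ d ∈ t, 0 < d) (h : ∀ j, (s.map (min · j)).sum = (t.map (min · j)).sum) : s = t := by
  ext c
  cases c with
  | zero =>
    rw [Multiset.count_eq_zero.2 fun h0 => (hs 0 h0).ne rfl,
      Multiset.count_eq_zero.2 fun h0 => (ht 0 h0).ne rfl]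
  | succ c =>
    have h1 := two_mul_sum_map_min s c
    have h2 := two_mul_sum_map_min t c
    rw [h, h, h] at h1
    omega

theorem List.eq_of_sum_map_min_eq {s t : List ℕ} (hs : s.Pairwise (· ≥ ·))
    (ht : t.Pairwise (· ≥ ·)) (hs0 : ∀ d ∈ s, 0 < d) (ht0 : ∀ d ∈ t, 0 < d)
    (h : ∀ j, (s.map (min · j)).sum = (t.map (min · j)).sum) : s = t := by
  have : (s : Multiset ℕ) = t :=
    Multiset.eq_of_sum_map_min_eq (by simpa using hs0) (by simpa using ht0) (by simpa using h)
  exact (Multiset.coe_eq_coe.1 this).eq_of_pairwise (fun a b _ _ h1 h2 => le_antisymm h2 h1) hs ht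

end Lists

/-! ### Nullities of matrices in Jordan form -/

section Nullity

variable {m : Type*} [Fintype m] [DecidableEq m]

theorem similar_sub_smul_pow {m' : Type*} [Fintype m'] [DecidableEq m'] {A : Matrix m m ℂ}
    {B : Matrix m' m' ℂ} {P : Matrix m m' ℂ} {Q : Matrix m' m ℂ} (hPQ : P * Q = 1)
    (hQP : Q * P = 1) (h : A = P * B * Q) (lam : ℂ) (j : ℕ) :
    (A - lam • (1 : Matrix m m ℂ)) ^ j = P * (B - lam • (1 : Matrix m' m' ℂ)) ^ j * Q := by
  have h1 : A - lam • (1 : Matrix m m ℂ) = P * (B - lam • (1 : Matrix m' m' ℂ)) * Q := by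
    rw [h, Matrix.mul_sub, Matrix.sub_mul]
    simp [hPQ]
  induction j with
  | zero => simp [hPQ]
  | succ j ih =>
    rw [pow_succ, ih, h1, pow_succ]
    calc _ = P * (B - lam • (1 : Matrix m' m' ℂ)) ^ j * (Q * P) *
          (B - lam • (1 : Matrix m' m' ℂ)) * Q := by simp only [Matrix.mul_assoc]
      _ = _ := by rw [hQP]; simp only [Matrix.mul_assoc, Matrix.mul_one]

theorem jordanNullity_of_similar {m' : Type*} [Fintype m'] [DecidableEq m'] {A : Matrix m m ℂ}
    {B : Matrix m' m' ℂ} {P : Matrix m m' ℂ} {Q : Matrix m' m ℂ} (hPQ : P * Q = 1)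
    (hQP : Q * P = 1) (h : A = P * B * Q) (lam : ℂ) (j : ℕ) :
    jordanNullity A lam j = jordanNullity B lam j := by
  rw [jordanNullity, jordanNullity, similar_sub_smul_pow hPQ hQP h]
  set C := (B - lam • (1 : Matrix m' m' ℂ)) ^ j
  let e : (m → ℂ) ≃ₗ[ℂ] (m' → ℂ) := toLin'OfInv hPQ hQP
  have h2 : LinearMap.ker (toLin' (P * C * Q)) = (LinearMap.ker (toLin' C)).comap e.toLinearMap := by
    ext v
    simp only [LinearMap.mem_ker, Submodule.mem_comap, toLin'_apply]
    change _ ↔ C *ᵥ (Q *ᵥ v) = 0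
    rw [← mulVec_mulVec, ← mulVec_mulVec]
    refine ⟨fun h => ?_, fun h => by rw [h, mulVec_zero]⟩
    have := congrArg (Q *ᵥ ·) h
    simpa [mulVec_mulVec, ← Matrix.mul_assoc, hQP] using this
  rw [h2]
  exact (e.ofSubmodule' _).finrank_eq

theorem finrank_ker_blockDiagonal' {ι : Type*} [Fintype ι] [DecidableEq ι] {κ : ι → Type*}
    [∀ i, Fintype (κ i)] [∀ i, DecidableEq (κ i)] (M : ∀ i, Matrix (κ i) (κ i) ℂ) :
    finrank ℂ (LinearMap.ker (toLin' (blockDiagonal' M))) =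
      ∑ i, finrank ℂ (LinearMap.ker (toLin' (M i))) := by
  have key : ∀ (v : (Σ i, κ i) → ℂ) (i : ι) (x : κ i),
      (blockDiagonal' M *ᵥ v) ⟨i, x⟩ = (M i *ᵥ fun y => v ⟨i, y⟩) x := by
    intro v i x
    simp only [mulVec, dotProduct, Fintype.sum_sigma]
    rw [Finset.sum_eq_single i]
    · simp [blockDiagonal'_apply_eq]
    · intro k _ hk
      exact Finset.sum_eq_zero fun y _ => by rw [blockDiagonal'_apply_ne _ _ _ hk.symm, zero_mul]
    · simp
  let e : LinearMap.ker (toLin' (blockDiagonal' M)) ≃ₗ[ℂ]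
      (∀ i, LinearMap.ker (toLin' (M i))) :=
    { toFun := fun v i => ⟨fun y => v.1 ⟨i, y⟩, by
        rw [LinearMap.mem_ker, toLin'_apply]
        ext x
        rw [← key, ← toLin'_apply, LinearMap.mem_ker.1 v.2]
        rfl⟩
      map_add' := fun _ _ => rfl
      map_smul' := fun _ _ => rfl
      invFun := fun w => ⟨fun p => (w p.1).1 p.2, by
        rw [LinearMap.mem_ker, toLin'_apply]
        ext ⟨i, x⟩
        rw [key, ← toLin'_apply, LinearMap.mem_ker.1 (w i).2]
        rfl⟩
      left_inv := fun _ => rfl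
      right_inv := fun _ => rfl }
  rw [e.finrank_eq, finrank_pi_fintype]

theorem finrank_ker_toLin'_eq_zero {A : Matrix m m ℂ} (h : A.det ≠ 0) :
    finrank ℂ (LinearMap.ker (toLin' A)) = 0 := by
  rw [LinearMap.ker_eq_bot.2, finrank_bot]
  exact mulVec_injective_iff_isUnit.2 ((isUnit_iff_isUnit_det _).2 h.isUnit)

theorem jordanNullity_eq_zero {A : Matrix m m ℂ} {lam : ℂ}
    (h : (A - lam • (1 : Matrix m m ℂ)).det ≠ 0) (j : ℕ) : jordanNullity A lam j = 0 :=
  finrank_ker_toLin'_eq_zero (by rw [det_pow]; exact pow_ne_zero _ h)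

theorem jordanBlock_sub_smul (lam ν : ℂ) (d : ℕ) :
    jordanBlock lam d - ν • (1 : Matrix (Fin d) (Fin d) ℂ) = jordanBlock (lam - ν) d := by
  ext i j
  by_cases h : i = j <;> simp [jordanBlock, h]

theorem det_jordanBlock (lam : ℂ) (d : ℕ) : (jordanBlock lam d).det = lam ^ d := by
  rw [det_of_isUpperTriangular]
  · simp [jordanBlock]
  · intro i j hij
    have h : j < i := hij
    have h1 : i ≠ j := h.ne'
    have h2 : (i : ℕ) + 1 ≠ j := by have := Fin.lt_def.1 h; omega
    simp [jordanBlock, h1, h2]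

theorem jordanBlock_zero_pow_apply (d j : ℕ) (i k : Fin d) :
    (jordanBlock 0 d ^ j) i k = if (i : ℕ) + j = k then 1 else 0 := by
  induction j generalizing i k with
  | zero => simp [Matrix.one_apply, Fin.ext_iff]
  | succ j ih =>
    rw [pow_succ', Matrix.mul_apply]
    simp only [ih]
    by_cases hi : (i : ℕ) + 1 < d
    · rw [Finset.sum_eq_single ⟨i + 1, hi⟩]
      · have : i ≠ ⟨i + 1, hi⟩ := by simp [Fin.ext_iff]
        simp [jordanBlock, this, add_assoc, add_comm 1 j]
      · intro b _ hb
        have : (i : ℕ) + 1 ≠ b := fun h => hb (by ext; simp [h])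
        simp [jordanBlock, this]
      · simp
    · rw [Finset.sum_eq_zero, if_neg (by omega)]
      intro b _
      have : (i : ℕ) + 1 ≠ b := by omega
      simp [jordanBlock, this]

/-- The `j`-th power of the nilpotent shift kills exactly the vectors whose coordinates of index at
least `j` vanish, that is, the kernel of a surjective restriction map. -/
theorem jordanNullity_jordanBlock_self (lam : ℂ) (d j : ℕ) :
    jordanNullity (jordanBlock lam d) lam j = min d j := by
  rw [jordanNullity, jordanBlock_sub_smul, sub_self]
  have h1 : LinearMap.ker (toLin' (jordanBlock 0 d ^ j)) =
      LinearMap.ker (LinearMap.funLeft ℂ ℂ (Subtype.val : {i : Fin d // j ≤ i} → Fin d)) := by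
    ext v
    have h2 : ∀ i : Fin d, (jordanBlock 0 d ^ j *ᵥ v) i =
        if h : (i : ℕ) + j < d then v ⟨i + j, h⟩ else 0 := by
      intro i
      simp only [mulVec, dotProduct, jordanBlock_zero_pow_apply]
      split_ifs with h
      · rw [Finset.sum_eq_single ⟨i + j, h⟩]
        · simp
        · intro b _ hb
          rw [if_neg (fun h => hb (by ext; simp [h])), zero_mul]
        · simp
      · exact Finset.sum_eq_zero fun b _ => by rw [if_neg (by omega), zero_mul]
    simp only [LinearMap.mem_ker, toLin'_apply, funext_iff, LinearMap.funLeft_apply, h2,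
      Pi.zero_apply, Subtype.forall]
    constructor
    · intro h i hi
      have h3 := h ⟨i - j, by omega⟩
      rw [dif_pos (by simp; omega)] at h3
      convert h3 using 2
      ext
      simp
      omega
    · intro h i
      split_ifs with hi
      · exact h _ (by simp)
      · rfl
  have h3 := LinearMap.finrank_range_add_finrank_ker
    (LinearMap.funLeft ℂ ℂ (Subtype.val : {i : Fin d // j ≤ i} → Fin d))
  rw [LinearMap.range_eq_top.2 (LinearMap.funLeft_surjective_of_injective _ _ _
    Subtype.val_injective), finrank_top, finrank_fintype_fun_eq_card, finrank_fintype_fun_eq_card,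
    Fintype.card_fin, Fintype.card_subtype] at h3
  have h4 : (Finset.univ.filter fun i : Fin d => j ≤ i).card = d - j := by
    have := Fin.card_filter_val_lt (n := d) (m := j)
    have h5 := Finset.card_filter_add_card_filter_not (s := Finset.univ)
      (fun i : Fin d => (i : ℕ) < j)
    simp only [not_lt, Finset.card_univ, Fintype.card_fin] at h5
    omega
  rw [h1]
  omega

theorem jordanNullity_jordanBlock (ev lam : ℂ) (d j : ℕ) :
    jordanNullity (jordanBlock ev d) lam j = if ev = lam then min d j else 0 := by
  split_ifs with h
  · rw [h, jordanNullity_jordanBlock_self]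
  · refine jordanNullity_eq_zero ?_ j
    rw [jordanBlock_sub_smul, det_jordanBlock]
    exact pow_ne_zero _ (sub_ne_zero.2 h)

theorem HasJordanForm.jordanNullity_eq {A : Matrix m m ℂ} {k : ℕ} {d : Fin k → ℕ}
    {ev : Fin k → ℂ} (h : HasJordanForm A d ev) (lam : ℂ) (j : ℕ) :
    jordanNullity A lam j =
      (((Finset.univ.filter fun i => ev i = lam).val.map d).map (min · j)).sum := by
  obtain ⟨-, P, Q, hPQ, hQP, rfl⟩ := h
  rw [jordanNullity_of_similar hPQ hQP rfl, jordanNullity, jordanMatrix,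
    ← blockDiagonal'_one, ← blockDiagonal'_smul, ← blockDiagonal'_sub, ← blockDiagonal'_pow,
    finrank_ker_blockDiagonal', Multiset.map_map]
  change _ = ∑ i ∈ Finset.univ.filter fun i => ev i = lam, min (d i) j
  rw [Finset.sum_filter]
  exact Finset.sum_congr rfl fun i _ => jordanNullity_jordanBlock _ _ _ _

end Nullity

/-! ### Jordan bases from the structure theorem over `ℂ[X]` -/

section Existence

open Polynomial

/-- The classes of the powers of `X - a`, in decreasing order, form a basis of
`ℂ[X] / (X - a) ^ d` over `ℂ`. -/
theorem exists_basis_quotient_X_sub_C_pow (a : ℂ) (d : ℕ) :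
    ∃ b : Basis (Fin d) ℂ (ℂ[X] ⧸ (Submodule.span ℂ[X] {(X - C a) ^ d})),
      ∀ j, b j = Submodule.Quotient.mk ((X - C a) ^ (d - 1 - (j : ℕ))) := by
  have hmonic : ((X - C a) ^ d).Monic := (monic_X_sub_C a).pow d
  let pb : Basis (Fin ((X - C a) ^ d).natDegree) ℂ
      (ℂ[X] ⧸ (Submodule.span ℂ[X] {(X - C a) ^ d})) :=
    AdjoinRoot.powerBasisAux' hmonic
  have hfin : finrank ℂ (ℂ[X] ⧸ (Submodule.span ℂ[X] {(X - C a) ^ d})) = d := by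
    rw [finrank_eq_card_basis pb, Fintype.card_fin, natDegree_pow, natDegree_X_sub_C, mul_one]
  have hspan : ⊤ ≤ Submodule.span ℂ (Set.range fun j : Fin d =>
      (Submodule.Quotient.mk ((X - C a) ^ (d - 1 - (j : ℕ))) :
        ℂ[X] ⧸ (Submodule.span ℂ[X] {(X - C a) ^ d}))) := by
    rintro x -
    obtain ⟨p, rfl⟩ := Submodule.Quotient.mk_surjective _ x
    -- The Taylor expansion at `a` gives spanning; independence then follows by counting dimensions.
    rw [← sum_taylor_eq p a, Polynomial.sum, ← Submodule.mkQ_apply, map_sum]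
    refine Submodule.sum_mem _ fun i _ => ?_
    rw [← smul_eq_C_mul]
    change Submodule.Quotient.mk _ ∈ _
    rw [Submodule.Quotient.mk_smul]
    refine Submodule.smul_mem _ _ ?_
    by_cases hi : i < d
    · refine Submodule.subset_span ⟨⟨d - 1 - i, by omega⟩, ?_⟩
      have : d - 1 - (d - 1 - i) = i := by omega
      simp only [this]
    · rw [(Submodule.Quotient.mk_eq_zero _).2]
      · exact Submodule.zero_mem _
      · exact Ideal.mem_span_singleton.2 (pow_dvd_pow _ (not_lt.1 hi))
  exact ⟨basisOfTopLeSpanOfCardEqFinrank _ hspan (by rw [hfin, Fintype.card_fin]),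
    fun j => by rw [coe_basisOfTopLeSpanOfCardEqFinrank]⟩

/-- Write `X = a + (X - a)`. Multiplication by `X - a` raises the exponent, hence lowers the index,
and sends the vector of index 0 to `(X - a) ^ d = 0`. -/
theorem X_smul_quotient_basis (a : ℂ) (d : ℕ)
    (b : Basis (Fin d) ℂ (ℂ[X] ⧸ (Submodule.span ℂ[X] {(X - C a) ^ d})))
    (hb : ∀ j, b j = Submodule.Quotient.mk ((X - C a) ^ (d - 1 - (j : ℕ)))) (j : Fin d) :
    (X : ℂ[X]) • b j = ∑ i, jordanBlock a d i j • b i := by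
  have h1 : (X : ℂ[X]) • b j = a • b j +
      Submodule.Quotient.mk ((X - C a) ^ (d - 1 - (j : ℕ) + 1)) := by
    rw [hb, ← Submodule.Quotient.mk_smul, ← Submodule.Quotient.mk_smul,
      ← Submodule.Quotient.mk_add]
    congr 1
    rw [smul_eq_mul, smul_eq_C_mul, pow_succ]
    ring
  rw [h1, ← Finset.add_sum_erase _ _ (Finset.mem_univ j)]
  congr 1
  · simp [jordanBlock]
  obtain ⟨j, hj⟩ := j
  cases j with
  | zero =>
    rw [Finset.sum_eq_zero]
    · rw [Submodule.Quotient.mk_eq_zero]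
      exact Ideal.mem_span_singleton.2 (pow_dvd_pow _ (by simp; omega))
    · intro i hi
      have : i ≠ ⟨0, hj⟩ := Finset.ne_of_mem_erase hi
      simp [jordanBlock, this]
  | succ j =>
    rw [Finset.sum_eq_single ⟨j, by omega⟩]
    · simp only [hb, jordanBlock, of_apply, Fin.mk.injEq]
      rw [if_neg (by omega), if_pos trivial, one_smul]
      congr 2
      omega
    · intro i hi hij
      have h2 : i ≠ ⟨j + 1, hj⟩ := Finset.ne_of_mem_erase hi
      have h3 : (i : ℕ) ≠ j := fun h => hij (Fin.ext h)
      simp [jordanBlock, h2, h3]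
    · intro h
      exact absurd (Finset.mem_erase.2 ⟨by simp [Fin.ext_iff], Finset.mem_univ _⟩) h

/-- With `X` acting as `f`, `V` is a torsion `ℂ[X]`-module, hence a sum of cyclic modules modulo
prime powers; over `ℂ` each prime is associated to some `X - a`. -/
theorem exists_jordan_basis {V : Type*} [AddCommGroup V] [Module ℂ V] [FiniteDimensional ℂ V]
    (f : End ℂ V) : ∃ (ι : Type) (_ : Fintype ι) (d : ι → ℕ) (ev : ι → ℂ)
      (b : Basis (Σ i, Fin (d i)) ℂ V), ∀ i j,
        f (b ⟨i, j⟩) = ∑ k, jordanBlock (ev i) (d i) k j • b ⟨i, k⟩ := by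
  classical
  obtain ⟨ι, hι, p, hp, d, ⟨e⟩⟩ := Module.equiv_directSum_of_isTorsion (R := ℂ[X])
    (M := AEval' f) (AEval.isTorsion_of_finiteDimensional ℂ V f)
  have hspan : ∀ i, ∃ a : ℂ, Submodule.span ℂ[X] {p i ^ d i} =
      Submodule.span ℂ[X] {(X - C a) ^ d i} := by
    intro i
    obtain ⟨a, ha⟩ := IsAlgClosed.exists_root (p i) (degree_pos_of_irreducible (hp i)).ne'
    refine ⟨a, Ideal.span_singleton_eq_span_singleton.2 (Associated.pow_pow ?_)⟩
    exact ((irreducible_X_sub_C a).associated_of_dvd (hp i) (dvd_iff_isRoot.2 ha)).symm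
  choose a ha using hspan
  choose b hb using fun i => exists_basis_quotient_X_sub_C_pow (a i) (d i)
  let q : ∀ i, (ℂ[X] ⧸ Submodule.span ℂ[X] {p i ^ d i}) ≃ₗ[ℂ[X]]
      (ℂ[X] ⧸ Submodule.span ℂ[X] {(X - C (a i)) ^ d i}) :=
    fun i => Submodule.quotEquivOfEq _ _ (ha i)
  let e' : AEval' f ≃ₗ[ℂ[X]] Π₀ i, (ℂ[X] ⧸ Submodule.span ℂ[X] {(X - C (a i)) ^ d i}) :=
    e.trans (DFinsupp.mapRange.linearEquiv q)
  let B : Basis (Σ i, Fin (d i)) ℂ V :=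
    (DFinsupp.basis b).map ((AEval'.of f).trans (e'.restrictScalars ℂ)).symm
  refine ⟨ι, hι, d, a, B, fun i j => ?_⟩
  let φ : ∀ i, (ℂ[X] ⧸ Submodule.span ℂ[X] {(X - C (a i)) ^ d i}) →ₗ[ℂ[X]] AEval' f :=
    fun i => e'.symm.toLinearMap ∘ₗ DFinsupp.lsingle (R := ℂ[X])
      (M := fun i => ℂ[X] ⧸ Submodule.span ℂ[X] {(X - C (a i)) ^ d i}) i
  have hB : ∀ i j, AEval'.of f (B ⟨i, j⟩) = φ i (b i j) := by
    intro i j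
    have h1 : DFinsupp.basis b ⟨i, j⟩ = DFinsupp.single i (b i j) := by
      simp [DFinsupp.basis]
    rw [Basis.map_apply, h1]
    exact LinearEquiv.apply_symm_apply (AEval'.of f) _
  apply (AEval'.of f).injective
  rw [← AEval'.X_smul_of, hB, ← (φ i).map_smul, X_smul_quotient_basis _ _ _ (hb i), map_sum,
    map_sum]
  exact Finset.sum_congr rfl fun k _ => by
    rw [(φ i).map_smul_of_tower, (AEval'.of f).map_smul, hB]

end Existence

/-! ### Jordan forms and Segre characteristics of matrices -/

variable {m : Type*} [Fintype m] [DecidableEq m]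

theorem exists_hasJordanForm (A : Matrix m m ℂ) :
    ∃ (k : ℕ) (d : Fin k → ℕ) (ev : Fin k → ℂ), HasJordanForm A d ev := by
  classical
  obtain ⟨ι, hι, d, ev, b, hb⟩ := exists_jordan_basis (toLin' A)
  -- The structure theorem may yield trivial summands; blocks of size 0 are discarded here.
  let σ := (Fintype.equivFin {i : ι // 0 < d i}).symm
  let g : (Σ i, Fin (d (σ i))) → Σ i, Fin (d i) := fun x => ⟨σ x.1, x.2⟩
  have hg : Function.Bijective g := by
    constructor
    · rintro ⟨i, x⟩ ⟨j, y⟩ h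
      simp only [g, Sigma.mk.injEq] at h
      obtain ⟨h1, h2⟩ := h
      obtain rfl := σ.injective (Subtype.ext h1)
      simpa using h2
    · rintro ⟨i, x⟩
      obtain ⟨j, hj⟩ := σ.surjective ⟨i, x.pos⟩
      have : (σ j : ι) = i := by rw [hj]
      subst this
      exact ⟨⟨j, x⟩, rfl⟩
  let c := b.reindex (Equiv.ofBijective g hg).symm
  have hc : ∀ i j, c ⟨i, j⟩ = b ⟨σ i, j⟩ := fun i j => by simp [c, g]
  refine ⟨_, fun i => d (σ i), fun i => ev (σ i), fun i => (σ i).2,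
    (Pi.basisFun ℂ m).toMatrix c, c.toMatrix (Pi.basisFun ℂ m),
    Basis.toMatrix_mul_toMatrix_flip _ _, Basis.toMatrix_mul_toMatrix_flip _ _, ?_⟩
  have h : A * (Pi.basisFun ℂ m).toMatrix c = (Pi.basisFun ℂ m).toMatrix c *
      jordanMatrix (fun i => d (σ i)) (fun i => ev (σ i)) := by
    ext x ⟨i, j⟩
    have h1 := congrFun (hb (σ i) j) x
    rw [toLin'_apply, ← hc, Finset.sum_apply] at h1
    have h2 : ∀ y p, (Pi.basisFun ℂ m).toMatrix c y p = c p y := fun y p => rfl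
    rw [Matrix.mul_apply, Matrix.mul_apply, Fintype.sum_sigma]
    refine h1.trans ?_
    rw [Finset.sum_eq_single i]
    · refine Finset.sum_congr rfl fun k _ => ?_
      rw [jordanMatrix, blockDiagonal'_apply_eq, Pi.smul_apply, smul_eq_mul, mul_comm, h2, hc]
    · intro k _ hk
      exact Finset.sum_eq_zero fun y _ => by
        rw [jordanMatrix, blockDiagonal'_apply_ne _ _ _ hk, mul_zero]
    · simp
  rw [← h, Matrix.mul_assoc, Basis.toMatrix_mul_toMatrix_flip, Matrix.mul_one]

theorem exists_isSegreCharacteristic (A : Matrix m m ℂ) (lam : ℂ) :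
    ∃ s, IsSegreCharacteristic A lam s := by
  obtain ⟨k, d, ev, h⟩ := exists_hasJordanForm A
  refine ⟨((Finset.univ.filter fun i => ev i = lam).val.map d).sort (· ≥ ·),
    Multiset.pairwise_sort _ _, k, d, ev, h, Multiset.sort_eq _ _⟩

theorem IsSegreCharacteristic.pos {A : Matrix m m ℂ} {lam : ℂ} {s : List ℕ}
    (h : IsSegreCharacteristic A lam s) : ∀ d ∈ s, 0 < d := by
  obtain ⟨-, k, d, ev, hJ, hs⟩ := h
  intro x hx
  have h1 : x ∈ (s : Multiset ℕ) := hx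
  rw [hs, Multiset.mem_map] at h1
  obtain ⟨i, -, rfl⟩ := h1
  exact hJ.1 i

theorem IsSegreCharacteristic.jordanNullity_eq {A : Matrix m m ℂ} {lam : ℂ} {s : List ℕ}
    (h : IsSegreCharacteristic A lam s) (j : ℕ) :
    jordanNullity A lam j = (s.map (min · j)).sum := by
  obtain ⟨-, k, d, ev, hJ, hs⟩ := h
  rw [hJ.jordanNullity_eq, ← hs]
  simp

theorem IsSegreCharacteristic.eq_of_jordanNullity {A : Matrix m m ℂ} {lam : ℂ} {s t : List ℕ}
    (h : IsSegreCharacteristic A lam s) (ht : t.Pairwise (· ≥ ·)) (ht0 : ∀ d ∈ t, 0 < d)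
    (hA : ∀ j, jordanNullity A lam j = (t.map (min · j)).sum) : s = t :=
  List.eq_of_sum_map_min_eq h.1 ht h.pos ht0 fun j => by rw [← hA, h.jordanNullity_eq]

/-- Some characteristic exists, and the nullities force it to be `t`. -/
theorem isSegreCharacteristic_of_jordanNullity {A : Matrix m m ℂ} {lam : ℂ} {t : List ℕ}
    (ht : t.Pairwise (· ≥ ·)) (ht0 : ∀ d ∈ t, 0 < d)
    (hA : ∀ j, jordanNullity A lam j = (t.map (min · j)).sum) : IsSegreCharacteristic A lam t := by
  obtain ⟨s, hs⟩ := exists_isSegreCharacteristic A lam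
  rwa [← hs.eq_of_jordanNullity ht ht0 hA]

/-! ### Splitting nullities along an invariant complement -/

section InvariantComplement

variable {m k : Type*} [Fintype m] [DecidableEq m] [Fintype k] [DecidableEq k]

theorem sub_smul_one_pow_mul_of_mul_eq {A : Matrix m m ℂ} {X : Matrix m k ℂ} {g : Matrix k k ℂ}
    (h : A * X = X * g) (ν : ℂ) (j : ℕ) :
    (A - ν • (1 : Matrix m m ℂ)) ^ j * X = X * (g - ν • (1 : Matrix k k ℂ)) ^ j := by
  induction j with
  | zero => simp
  | succ j ih =>
    have h1 : (A - ν • (1 : Matrix m m ℂ)) * X = X * (g - ν • (1 : Matrix k k ℂ)) := by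
      rw [Matrix.sub_mul, Matrix.mul_sub, h]
      simp
    rw [pow_succ, Matrix.mul_assoc, h1, ← Matrix.mul_assoc, ih, Matrix.mul_assoc, ← pow_succ]

theorem mul_sub_smul_one_pow_of_mul_eq {A : Matrix m m ℂ} {Y : Matrix k m ℂ} {L : Matrix k k ℂ}
    (h : Y * A = L * Y) (ν : ℂ) (j : ℕ) :
    Y * (A - ν • (1 : Matrix m m ℂ)) ^ j = (L - ν • (1 : Matrix k k ℂ)) ^ j * Y :=
  (sub_smul_one_pow_mul_of_mul_eq h.symm ν j).symm

/-- If the range of `X` and the kernel of `Y` are complementary and invariant under `A`, the kernel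
of `(A - ν) ^ j` splits accordingly. -/
theorem jordanNullity_eq_add {A : Matrix m m ℂ} {X : Matrix m k ℂ} {Y : Matrix k m ℂ}
    {g L K : Matrix k k ℂ} (hK : K * (Y * X) = 1) (hX : A * X = X * g) (hY : Y * A = L * Y)
    (ν : ℂ) (j : ℕ) :
    jordanNullity A ν j = jordanNullity g ν j +
      finrank ℂ ↥(LinearMap.ker (toLin' ((A - ν • (1 : Matrix m m ℂ)) ^ j)) ⊓
        LinearMap.ker (toLin' Y)) := by
  have hX' := sub_smul_one_pow_mul_of_mul_eq hX ν j
  have hY' := mul_sub_smul_one_pow_of_mul_eq hY ν j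
  rw [jordanNullity, jordanNullity]
  set B := (A - ν • (1 : Matrix m m ℂ)) ^ j
  set b := (g - ν • (1 : Matrix k k ℂ)) ^ j
  have hinj : ∀ v, Y *ᵥ (X *ᵥ v) = 0 → v = 0 := fun v hv => by
    have := congrArg (K *ᵥ ·) hv
    simpa only [mulVec_mulVec, hK, one_mulVec, mulVec_zero] using this
  have hXinj : Function.Injective (toLin' X) := by
    rw [← LinearMap.ker_eq_bot, LinearMap.ker_eq_bot']
    intro v hv
    refine hinj v ?_
    rw [← toLin'_apply X, hv, mulVec_zero]
  have hK' : Y * X * K = 1 := mul_eq_one_comm.1 hK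
  have hsup : LinearMap.ker (toLin' B) = (LinearMap.ker (toLin' b)).map (toLin' X) ⊔
      (LinearMap.ker (toLin' B) ⊓ LinearMap.ker (toLin' Y)) := by
    apply le_antisymm
    · intro v hv
      rw [LinearMap.mem_ker, toLin'_apply] at hv
      -- `X K Y` is the projection onto the range of `X` along the kernel of `Y`.
      have h1 : Y *ᵥ (v - X *ᵥ (K *ᵥ (Y *ᵥ v))) = 0 := by
        rw [mulVec_sub, mulVec_mulVec, mulVec_mulVec, hK', one_mulVec, sub_self]
      have h2 : b *ᵥ (K *ᵥ (Y *ᵥ v)) = 0 := by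
        refine hinj _ ?_
        rw [mulVec_mulVec _ X, ← hX', mulVec_mulVec, ← Matrix.mul_assoc, hY']
        have h3 := congrArg ((L - ν • (1 : Matrix k k ℂ)) ^ j *ᵥ ·) h1
        simp only [mulVec_sub, mulVec_zero] at h3
        rw [mulVec_mulVec, ← hY', ← mulVec_mulVec, hv, mulVec_zero, zero_sub, neg_eq_zero] at h3
        simpa only [mulVec_mulVec, Matrix.mul_assoc] using h3
      rw [← add_sub_cancel (X *ᵥ (K *ᵥ (Y *ᵥ v))) v]
      refine Submodule.add_mem_sup ⟨K *ᵥ (Y *ᵥ v), h2, rfl⟩ ⟨?_, h1⟩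
      simp only [SetLike.mem_coe, LinearMap.mem_ker, toLin'_apply]
      rw [mulVec_sub, hv, mulVec_mulVec, hX', ← mulVec_mulVec, h2, mulVec_zero, sub_zero]
    · refine sup_le ?_ inf_le_left
      rintro _ ⟨v, hv, rfl⟩
      have hv' : b *ᵥ v = 0 := hv
      rw [LinearMap.mem_ker, toLin'_apply, toLin'_apply, mulVec_mulVec, hX', ← mulVec_mulVec, hv',
        mulVec_zero]
  have hinf : (LinearMap.ker (toLin' b)).map (toLin' X) ⊓
      (LinearMap.ker (toLin' B) ⊓ LinearMap.ker (toLin' Y)) = ⊥ := by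
    rw [eq_bot_iff]
    rintro _ ⟨⟨v, -, rfl⟩, -, hv⟩
    rw [hinj v hv, map_zero]
    exact Submodule.zero_mem _
  have h := Submodule.finrank_sup_add_finrank_inf_eq
    ((LinearMap.ker (toLin' b)).map (toLin' X))
    (LinearMap.ker (toLin' B) ⊓ LinearMap.ker (toLin' Y))
  rw [hinf, finrank_bot, add_zero, ← hsup] at h
  rw [h, LinearEquiv.finrank_eq (Submodule.equivMapOfInjective _ hXinj _)]

/-- Adding a multiple of `Y` does not change the action on the kernel of `Y`. -/
theorem ker_add_mul_inf_ker {A : Matrix m m ℂ} {Y : Matrix k m ℂ} {L : Matrix k k ℂ}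
    (hY : Y * A = L * Y) (Z : Matrix m k ℂ) (ν : ℂ) (j : ℕ) :
    LinearMap.ker (toLin' ((A + Z * Y - ν • (1 : Matrix m m ℂ)) ^ j)) ⊓ LinearMap.ker (toLin' Y) =
      LinearMap.ker (toLin' ((A - ν • (1 : Matrix m m ℂ)) ^ j)) ⊓ LinearMap.ker (toLin' Y) := by
  -- Since `Y` passes through `A` at the cost of `L`, every correction term in the power keeps a
  -- right factor `Y`.
  have key : ∃ T : Matrix m k ℂ, (A + Z * Y - ν • (1 : Matrix m m ℂ)) ^ j =
      (A - ν • (1 : Matrix m m ℂ)) ^ j + T * Y := by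
    induction j with
    | zero => exact ⟨0, by simp⟩
    | succ j ih =>
      obtain ⟨T, hT⟩ := ih
      refine ⟨(A - ν • (1 : Matrix m m ℂ) + Z * Y) * T + Z * (L - ν • (1 : Matrix k k ℂ)) ^ j, ?_⟩
      have h1 := mul_sub_smul_one_pow_of_mul_eq hY ν j
      rw [pow_succ', hT, pow_succ', add_sub_right_comm, Matrix.mul_add, Matrix.add_mul,
        Matrix.add_mul, Matrix.add_mul, Matrix.mul_assoc Z, Matrix.mul_assoc Z,
        Matrix.mul_assoc Z (_ ^ j), ← h1, Matrix.mul_assoc _ T Y, Matrix.add_mul _ _ (T * Y),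
        Matrix.mul_assoc Z Y]
      abel
  obtain ⟨T, hT⟩ := key
  ext v
  simp only [Submodule.mem_inf, LinearMap.mem_ker, toLin'_apply]
  refine and_congr_left fun hv => ?_
  rw [hT, add_mulVec, ← mulVec_mulVec v T, hv, mulVec_zero, add_zero]

end InvariantComplement

/-! ### Nullities of 2 × 2 matrices -/

section TwoByTwo

theorem finrank_ker_of_det_eq_zero {N : Matrix (Fin 2) (Fin 2) ℂ} (h0 : N.det = 0) (hN : N ≠ 0) :
    finrank ℂ (LinearMap.ker (toLin' N)) = 1 := by
  have h1 := LinearMap.finrank_range_add_finrank_ker (toLin' N)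
  rw [finrank_fintype_fun_eq_card, Fintype.card_fin] at h1
  have h2 : finrank ℂ (LinearMap.range (toLin' N)) ≠ 0 := by
    rw [Ne, Submodule.finrank_eq_zero, LinearMap.range_eq_bot]
    simpa using hN
  have h3 : finrank ℂ (LinearMap.ker (toLin' N)) ≠ 0 := by
    rw [Ne, Submodule.finrank_eq_zero, LinearMap.ker_eq_bot]
    intro h
    have := (isUnit_iff_isUnit_det _).1 (mulVec_injective_iff_isUnit.1 h)
    exact this.ne_zero h0
  omega

/-- This is Cayley–Hamilton for vanishing determinant. It makes all positive powers multiples of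
`N`, so the trace separates the semisimple case from the nilpotent one. -/
theorem sq_eq_trace_smul {N : Matrix (Fin 2) (Fin 2) ℂ} (h0 : N.det = 0) :
    N ^ 2 = N.trace • N := by
  rw [det_fin_two] at h0
  rw [pow_two, trace_fin_two]
  ext i j
  fin_cases i <;> fin_cases j <;> simp [Matrix.mul_apply, Fin.sum_univ_two] <;>
    first | ring1 | linear_combination -h0

theorem pow_succ_eq_trace_pow_smul {N : Matrix (Fin 2) (Fin 2) ℂ} (h0 : N.det = 0) (j : ℕ) :
    N ^ (j + 1) = N.trace ^ j • N := by
  induction j with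
  | zero => simp
  | succ j ih =>
    rw [pow_succ, ih, smul_mul_assoc, ← pow_two, sq_eq_trace_smul h0, smul_smul, pow_succ]

theorem jordanNullity_of_eq_smul_one (ν : ℂ) (j : ℕ) :
    jordanNullity (ν • (1 : Matrix (Fin 2) (Fin 2) ℂ)) ν j = min 1 j + min 1 j := by
  rw [jordanNullity, sub_self]
  cases j with
  | zero => simp [LinearMap.ker_id]
  | succ j =>
    rw [zero_pow (Nat.succ_ne_zero j), map_zero, LinearMap.ker_zero, finrank_top,
      finrank_fintype_fun_eq_card, Fintype.card_fin]
    omega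

theorem jordanNullity_of_trace_ne {g : Matrix (Fin 2) (Fin 2) ℂ} {ν : ℂ}
    (h0 : (g - ν • (1 : Matrix (Fin 2) (Fin 2) ℂ)).det = 0)
    (ht : (g - ν • (1 : Matrix (Fin 2) (Fin 2) ℂ)).trace ≠ 0) (j : ℕ) :
    jordanNullity g ν j = min 1 j := by
  rw [jordanNullity]
  cases j with
  | zero => simp [LinearMap.ker_id]
  | succ j =>
    rw [pow_succ_eq_trace_pow_smul h0, finrank_ker_of_det_eq_zero]
    · omega
    · rw [det_smul, h0, mul_zero]
    · refine smul_ne_zero (pow_ne_zero _ ht) fun h => ht ?_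
      rw [h, trace_zero]

theorem jordanNullity_of_trace_eq_zero {g : Matrix (Fin 2) (Fin 2) ℂ} {ν : ℂ}
    (h0 : (g - ν • (1 : Matrix (Fin 2) (Fin 2) ℂ)).det = 0)
    (ht : (g - ν • (1 : Matrix (Fin 2) (Fin 2) ℂ)).trace = 0) (hg : g ≠ ν • 1) (j : ℕ) :
    jordanNullity g ν j = min 2 j := by
  rw [jordanNullity]
  match j with
  | 0 => simp [LinearMap.ker_id]
  | 1 =>
    rw [pow_one, finrank_ker_of_det_eq_zero h0 (sub_ne_zero.2 hg)]
    rfl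
  | j + 2 =>
    rw [pow_succ_eq_trace_pow_smul h0, ht, zero_pow (Nat.succ_ne_zero j), zero_smul, map_zero,
      LinearMap.ker_zero, finrank_top, finrank_fintype_fun_eq_card, Fintype.card_fin]
    omega

end TwoByTwo

/-- The matrix of `Ŝ` on the span of the two eigenvectors. -/
noncomputable def spanMatrix (lam : ℂ) (R : Matrix (Fin 2) (Fin 2) ℂ) : Matrix (Fin 2) (Fin 2) ℂ :=
  !![(1 + R 0 1) * lam, -(R 0 0 * lam⁻¹); R 1 1 * lam, (1 - R 1 0) * lam⁻¹]

/-! ### The action of `Ŝ` on the span of the eigenvectors -/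

section SpanMatrix

variable {lam μ : ℂ} {R : Matrix (Fin 2) (Fin 2) ℂ}

theorem diagonal_add_mul_eq_spanMatrix (lam : ℂ) (R : Matrix (Fin 2) (Fin 2) ℂ) :
    diagonal ![lam, lam⁻¹] + R * matJ2ᵀ * diagonal ![lam, lam⁻¹] = spanMatrix lam R := by
  ext i j
  fin_cases i <;> fin_cases j <;>
    simp [spanMatrix, matJ2, Matrix.mul_apply, Fin.sum_univ_two, diagonal] <;> ring

theorem trace_spanMatrix_sub
    (hR1 : (μ + μ⁻¹) - (lam + lam⁻¹) = lam * R 0 1 - lam⁻¹ * R 1 0) (ν : ℂ) :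
    (spanMatrix lam R - ν • (1 : Matrix (Fin 2) (Fin 2) ℂ)).trace = μ + μ⁻¹ - 2 * ν := by
  rw [trace_fin_two]
  simp [spanMatrix]
  linear_combination -hR1

/-- The first condition on `R` says that `spanMatrix lam R` has trace `μ + μ⁻¹`, the second that it
has determinant 1. -/
theorem det_spanMatrix_sub (hlam : lam ≠ 0) (hμ : μ ≠ 0)
    (hR1 : (μ + μ⁻¹) - (lam + lam⁻¹) = lam * R 0 1 - lam⁻¹ * R 1 0)
    (hR2 : 0 = R 0 1 - R 1 0 + R 0 0 * R 1 1 - R 0 1 * R 1 0) (ν : ℂ) :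
    (spanMatrix lam R - ν • (1 : Matrix (Fin 2) (Fin 2) ℂ)).det = (ν - μ) * (ν - μ⁻¹) := by
  rw [det_fin_two]
  simp [spanMatrix]
  have h1 : lam * lam⁻¹ = 1 := mul_inv_cancel₀ hlam
  have h2 : μ * μ⁻¹ = 1 := mul_inv_cancel₀ hμ
  linear_combination ν * hR1 - hR2 - h2 + (1 + R 0 1 - R 1 0 + R 0 0 * R 1 1 - R 0 1 * R 1 0) * h1

theorem spanMatrix_eq_smul_one_iff (hlam : lam ≠ 0) (hμ : μ ≠ 0) (hμμ : μ = μ⁻¹) :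
    spanMatrix lam R = μ • (1 : Matrix (Fin 2) (Fin 2) ℂ) ↔ R = matR1 lam μ ∨ R = matR2 lam μ := by
  have hsq : μ * μ = 1 := by
    nth_rewrite 2 [hμμ]
    exact mul_inv_cancel₀ hμ
  have hl : lam * lam⁻¹ = 1 := mul_inv_cancel₀ hlam
  -- For `μ = μ⁻¹` the two alternatives coincide.
  have h12 : matR2 lam μ = matR1 lam μ := by
    ext i j
    fin_cases i <;> fin_cases j <;> simp [matR1, matR2, ← hμμ]
    · linear_combination hl - hsq
    · linear_combination hl - hsq
  rw [h12, or_self]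
  constructor
  · intro h
    have h00 := congrFun₂ h 0 0
    have h01 := congrFun₂ h 0 1
    have h10 := congrFun₂ h 1 0
    have h11 := congrFun₂ h 1 1
    simp [spanMatrix, hlam] at h00 h01 h10 h11
    ext i j
    fin_cases i <;> fin_cases j <;> simp [matR1, ← hμμ]
    · exact h01
    · linear_combination lam⁻¹ * h00 - R 0 1 * hl
    · linear_combination -lam * h11 - (R 1 0 - 1) * hl - hsq
    · exact h10
  · rintro rfl
    ext i j
    fin_cases i <;> fin_cases j <;> simp [spanMatrix, matR1, ← hμμ]
    · linear_combination (μ - lam) * hl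
    · linear_combination μ * hl - lam⁻¹ * hsq

end SpanMatrix

/-! ### Comparison of `S` and `Ŝ` -/

section Symplectic

variable {n : ℕ} {S : Matrix (Fin n ⊕ Fin n) (Fin n ⊕ Fin n) ℂ} {lam : ℂ}
  {x₁ x₂ : Fin n ⊕ Fin n → ℂ}

theorem matJ_transpose (n : ℕ) : (matJ n)ᵀ = -matJ n := by
  simp [matJ, fromBlocks_transpose, fromBlocks_neg]

theorem mul_colPair_eq (hx₁ : Module.End.HasEigenvector (Matrix.toLin' S) lam x₁)
    (hx₂ : Module.End.HasEigenvector (Matrix.toLin' S) lam⁻¹ x₂) :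
    S * colPair x₁ x₂ = colPair x₁ x₂ * diagonal ![lam, lam⁻¹] := by
  have h1 := hx₁.apply_eq_smul
  have h2 := hx₂.apply_eq_smul
  rw [toLin'_apply] at h1 h2
  ext i j
  rw [mul_diagonal]
  fin_cases j
  · refine (congrFun h1 i).trans ?_
    simp [colPair, mul_comm]
  · refine (congrFun h2 i).trans ?_
    simp [colPair, mul_comm]

/-- If `S X = X D` with `D` symmetric, then `Xᵀ J` intertwines `S` with the inverse of `D`. -/
theorem diagonal_mul_transpose_mul_matJ {X : Matrix (Fin n ⊕ Fin n) (Fin 2) ℂ}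
    {D : Matrix (Fin 2) (Fin 2) ℂ} (hS : IsSymplecticMatrix S)
    (hX : S * X = X * D) (hD : Dᵀ = D) : D * (Xᵀ * matJ n) * S = Xᵀ * matJ n := by
  have h1 : Xᵀ * Sᵀ = D * Xᵀ := by rw [← transpose_mul, hX, transpose_mul, hD]
  rw [← Matrix.mul_assoc, ← h1, Matrix.mul_assoc, Matrix.mul_assoc, ← Matrix.mul_assoc Sᵀ, hS]

theorem eigenvalue_ne_zero {X : Matrix (Fin n ⊕ Fin n) (Fin 2) ℂ} (hS : IsSymplecticMatrix S)
    (hX : S * X = X * diagonal ![lam, lam⁻¹]) (hJ : Xᵀ * matJ n * X = matJ2) : lam ≠ 0 := by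
  rintro rfl
  -- With the convention `0⁻¹ = 0` both diagonal entries vanish; this forces `Xᵀ J = 0`,
  -- contradicting `Xᵀ J X = J₂`.
  have h0 : diagonal ![(0 : ℂ), 0⁻¹] = 0 := by
    ext i j
    fin_cases i <;> fin_cases j <;> simp
  have h1 := diagonal_mul_transpose_mul_matJ hS hX (diagonal_transpose _)
  rw [h0, Matrix.zero_mul, Matrix.zero_mul] at h1
  rw [← h1, Matrix.zero_mul] at hJ
  simpa [matJ2] using congrFun₂ hJ 0 1

/-- The kernel of `(S - ν) ^ j` and that of `(Ŝ - ν) ^ j` have the same part outside the span of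
the two eigenvectors. -/
theorem exists_common_nullity (hS : IsSymplecticMatrix S)
    (hx₁ : Module.End.HasEigenvector (Matrix.toLin' S) lam x₁)
    (hx₂ : Module.End.HasEigenvector (Matrix.toLin' S) lam⁻¹ x₂)
    (hJ : (colPair x₁ x₂)ᵀ * matJ n * colPair x₁ x₂ = matJ2) (R : Matrix (Fin 2) (Fin 2) ℂ)
    (ν : ℂ) (j : ℕ) :
    ∃ w, jordanNullity S ν j = jordanNullity (diagonal ![lam, lam⁻¹]) ν j + w ∧
      jordanNullity (modifiedMatrix S (colPair x₁ x₂) R) ν j =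
        jordanNullity (spanMatrix lam R) ν j + w := by
  have hX := mul_colPair_eq hx₁ hx₂
  have hlam := eigenvalue_ne_zero hS hX hJ
  set X := colPair x₁ x₂
  have hinv : diagonal ![lam⁻¹, lam] * diagonal ![lam, lam⁻¹] = 1 := by
    ext i j
    fin_cases i <;> fin_cases j <;> simp [hlam]
  have hY : Xᵀ * matJ n * S = diagonal ![lam⁻¹, lam] * (Xᵀ * matJ n) := by
    nth_rewrite 2 [← diagonal_mul_transpose_mul_matJ hS hX (diagonal_transpose _)]
    rw [Matrix.mul_assoc (diagonal ![lam, lam⁻¹]), ← Matrix.mul_assoc, hinv, Matrix.one_mul]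
  have hK : matJ2ᵀ * (Xᵀ * matJ n * X) = 1 := by
    rw [hJ]
    ext i j
    fin_cases i <;> fin_cases j <;> simp [matJ2, Matrix.mul_apply, Fin.sum_univ_two]
  -- The modification has right factor `Xᵀ J`, so it vanishes on the kernel of that matrix; the sign
  -- comes from `Jᵀ = -J`.
  have hmod : modifiedMatrix S X R = S + -(X * R * diagonal ![lam⁻¹, lam]) * (Xᵀ * matJ n) := by
    rw [modifiedMatrix, matJ_transpose, Matrix.neg_mul, Matrix.mul_assoc _ _ (Xᵀ * matJ n), ← hY]
    simp only [Matrix.mul_assoc, Matrix.mul_neg, Matrix.neg_mul]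
  have hmodX : modifiedMatrix S X R * X = X * spanMatrix lam R := by
    have hJ' : Xᵀ * (matJ n)ᵀ * X = matJ2ᵀ := by
      rw [← hJ, transpose_mul, transpose_mul, transpose_transpose, Matrix.mul_assoc]
    rw [modifiedMatrix, ← diagonal_add_mul_eq_spanMatrix, Matrix.add_mul, Matrix.mul_assoc _ S X,
      hX, Matrix.mul_add, ← hJ']
    simp only [Matrix.mul_assoc]
  have hmodY : Xᵀ * matJ n * modifiedMatrix S X R =
      ((1 - matJ2 * R) * diagonal ![lam⁻¹, lam]) * (Xᵀ * matJ n) := by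
    rw [hmod, Matrix.mul_add, hY, ← hJ]
    rw [Matrix.sub_mul, Matrix.sub_mul, Matrix.one_mul, sub_eq_add_neg]
    simp only [Matrix.mul_assoc, Matrix.neg_mul, Matrix.mul_neg]
  refine ⟨_, jordanNullity_eq_add hK hX hY ν j, ?_⟩
  rw [jordanNullity_eq_add hK hmodX hmodY ν j, hmod, ker_add_mul_inf_ker hY]

theorem inv_ne_self_of_ne {z : ℂ} (h1 : z ≠ 1) (h2 : z ≠ -1) (h0 : z ≠ 0) : z⁻¹ ≠ z := by
  intro h
  have h3 : z * z = 1 := by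
    nth_rewrite 2 [← h]
    exact mul_inv_cancel₀ h0
  rcases mul_self_eq_one_iff.1 h3 with h | h
  exacts [h1 h, h2 h]

theorem jordanNullity_diagonal_of_ne (h : lam⁻¹ ≠ lam) (j : ℕ) :
    jordanNullity (diagonal ![lam, lam⁻¹]) lam j = min 1 j := by
  apply jordanNullity_of_trace_ne
  · simp [det_fin_two]
  · rw [trace_fin_two]
    intro h1
    simp at h1
    exact h (by linear_combination h1)

theorem jordanNullity_diagonal_of_eq (h : lam⁻¹ = lam) (j : ℕ) :
    jordanNullity (diagonal ![lam, lam⁻¹]) lam j = min 1 j + min 1 j := by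
  have h1 : diagonal ![lam, lam⁻¹] = lam • (1 : Matrix (Fin 2) (Fin 2) ℂ) := by
    ext i j
    fin_cases i <;> fin_cases j <;> simp [h]
  rw [h1, jordanNullity_of_eq_smul_one]

theorem pairwise_append_replicate_one {s : List ℕ} (hs : s.Pairwise (· ≥ ·))
    (hs0 : ∀ d ∈ s, 0 < d) (r : ℕ) : (s ++ List.replicate r 1).Pairwise (· ≥ ·) := by
  refine List.pairwise_append.2 ⟨hs, List.pairwise_replicate.2 (Or.inr le_rfl), ?_⟩
  intro a ha b hb
  rw [List.eq_of_mem_replicate hb]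
  exact hs0 a ha

/-- The excess `r * min 1 j` is the contribution of `r` blocks of size 1, which come last because
all sizes are positive. This yields `s₁ = 1` as a conclusion. -/
theorem IsSegreCharacteristic.eq_append_replicate_one {m m' : Type*} [Fintype m] [DecidableEq m]
    [Fintype m'] [DecidableEq m'] {A : Matrix m m ℂ} {B : Matrix m' m' ℂ} {ν : ℂ}
    {s t : List ℕ} (ht : IsSegreCharacteristic A ν t) (hs : IsSegreCharacteristic B ν s) (r : ℕ)
    (h : ∀ j, jordanNullity A ν j = jordanNullity B ν j + r * min 1 j) :
    t = s ++ List.replicate r 1 := by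
  refine ht.eq_of_jordanNullity (pairwise_append_replicate_one hs.1 hs.pos r) ?_ fun j => ?_
  · intro d hd
    rcases List.mem_append.1 hd with hd | hd
    · exact hs.pos d hd
    · rw [List.eq_of_mem_replicate hd]
      exact one_pos
  · rw [h, hs.jordanNullity_eq]
    simp

theorem jordanNullity_eq_zero_of_notMem_spectrum {m : Type*} [Fintype m] [DecidableEq m]
    {A : Matrix m m ℂ} {ν : ℂ} (h : ν ∉ spectrum ℂ A) (j : ℕ) : jordanNullity A ν j = 0 := by
  refine jordanNullity_eq_zero ?_ j
  rw [spectrum.notMem_iff, Algebra.algebraMap_eq_smul_one, ← IsUnit.neg_iff, neg_sub,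
    isUnit_iff_isUnit_det] at h
  exact h.ne_zero

end Symplectic

theorem theorem4p3 (n : ℕ) (S : Matrix (Fin n ⊕ Fin n) (Fin n ⊕ Fin n) ℂ)
    (hS : IsSymplecticMatrix S)
    (lam μ : ℂ) (hμ0 : μ ≠ 0) (hμ1 : μ ≠ lam) (hμ2 : μ ≠ lam⁻¹)
    (x₁ x₂ : Fin n ⊕ Fin n → ℂ)
    (hx₁ : Module.End.HasEigenvector (Matrix.toLin' S) lam x₁)
    (hx₂ : Module.End.HasEigenvector (Matrix.toLin' S) lam⁻¹ x₂)
    (hX : (colPair x₁ x₂)ᵀ * matJ n * colPair x₁ x₂ = matJ2)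
    (R : Matrix (Fin 2) (Fin 2) ℂ)
    (hR1 : (μ + μ⁻¹) - (lam + lam⁻¹) = lam * R 0 1 - lam⁻¹ * R 1 0)
    (hR2 : 0 = R 0 1 - R 1 0 + R 0 0 * R 1 1 - R 0 1 * R 1 0) :
    ((lam ≠ 1 ∧ lam ≠ -1 → ∀ t : List ℕ, IsSegreCharacteristic S lam t →
        ∃ s : List ℕ, t = s ++ [1] ∧
          IsSegreCharacteristic (modifiedMatrix S (colPair x₁ x₂) R) lam s) ∧
      (lam = 1 ∨ lam = -1 → ∀ t : List ℕ, IsSegreCharacteristic S lam t →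
        ∃ s : List ℕ, t = s ++ [1, 1] ∧
          IsSegreCharacteristic (modifiedMatrix S (colPair x₁ x₂) R) lam s)) ∧
    (μ ∉ spectrum ℂ S →
      (μ ≠ μ⁻¹ → IsSegreCharacteristic (modifiedMatrix S (colPair x₁ x₂) R) μ [1]) ∧
      (μ = μ⁻¹ →
        (IsSegreCharacteristic (modifiedMatrix S (colPair x₁ x₂) R) μ [1, 1] ↔
          R = matR1 lam μ ∨ R = matR2 lam μ) ∧
        (¬(R = matR1 lam μ ∨ R = matR2 lam μ) →
          IsSegreCharacteristic (modifiedMatrix S (colPair x₁ x₂) R) μ [2]))) := by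
  have hD := mul_colPair_eq hx₁ hx₂
  have hlam := eigenvalue_ne_zero hS hD hX
  have hw := exists_common_nullity hS hx₁ hx₂ hX R
  set T := modifiedMatrix S (colPair x₁ x₂) R
  have hdet := det_spanMatrix_sub hlam hμ0 hR1 hR2
  -- Neither `μ` nor `μ⁻¹` equals `lam`, so the new 2 × 2 summand contributes nothing at `lam`.
  have hMlam : ∀ j, jordanNullity (spanMatrix lam R) lam j = 0 := by
    refine jordanNullity_eq_zero ?_
    rw [hdet]
    refine mul_ne_zero (sub_ne_zero.2 hμ1.symm) (sub_ne_zero.2 fun h => hμ2 ?_)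
    rw [h, inv_inv]
  obtain ⟨s, hs⟩ := exists_isSegreCharacteristic T lam
  refine ⟨⟨fun hne t ht => ⟨s, ?_, hs⟩, fun heq t ht => ⟨s, ?_, hs⟩⟩, fun hμS => ?_⟩
  · refine ht.eq_append_replicate_one hs 1 fun j => ?_
    obtain ⟨w, h1, h2⟩ := hw lam j
    rw [h1, h2, hMlam, jordanNullity_diagonal_of_ne (inv_ne_self_of_ne hne.1 hne.2 hlam)]
    omega
  · refine ht.eq_append_replicate_one hs 2 fun j => ?_
    obtain ⟨w, h1, h2⟩ := hw lam j
    rw [h1, h2, hMlam, jordanNullity_diagonal_of_eq (by rcases heq with rfl | rfl <;> norm_num)]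
    omega
  have hTμ : ∀ j, jordanNullity T μ j = jordanNullity (spanMatrix lam R) μ j := by
    intro j
    obtain ⟨w, h1, h2⟩ := hw μ j
    -- As `μ` is not an eigenvalue of `S`, the common part `w` is 0.
    rw [jordanNullity_eq_zero_of_notMem_spectrum hμS] at h1
    omega
  have hdetμ : (spanMatrix lam R - μ • (1 : Matrix (Fin 2) (Fin 2) ℂ)).det = 0 := by
    rw [hdet, sub_self, zero_mul]
  have htr := trace_spanMatrix_sub hR1 μ
  refine ⟨fun hne => ?_, fun heq => ?_⟩
  · refine isSegreCharacteristic_of_jordanNullity (by simp) (by simp) fun j => ?_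
    rw [hTμ, jordanNullity_of_trace_ne hdetμ]
    · simp
    · rw [htr]
      intro h
      exact hne (by linear_combination -h)
  · rw [← spanMatrix_eq_smul_one_iff hlam hμ0 heq]
    have hne : spanMatrix lam R ≠ μ • 1 → IsSegreCharacteristic T μ [2] := by
      intro h
      refine isSegreCharacteristic_of_jordanNullity (by simp) (by simp) fun j => ?_
      rw [hTμ, jordanNullity_of_trace_eq_zero hdetμ _ h]
      · simp
      · rw [htr, ← heq]
        ring
    refine ⟨⟨fun h => ?_, fun h => ?_⟩, hne⟩
    · by_contra hc
      -- The kernel of `Ŝ - μ` has dimension 2 for `[1, 1]` but 1 for `[2]`.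
      have h1 := h.jordanNullity_eq 1
      rw [(hne hc).jordanNullity_eq] at h1
      simp at h1
    · refine isSegreCharacteristic_of_jordanNullity (by simp) (by simp) fun j => ?_
      rw [hTμ, h, jordanNullity_of_eq_smul_one]
      simp
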